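/- For each $n$ let $p_n=a_n/n$ and $q_n=b_n/n$ be in $[0,1]$. Let $(\sigma,G)$ be drawn from the planted partition model $\mathcal G(n,p_n,q_n)$: each of the $n$ vertices receives, independently and uniformly at random, a label $\sigma_u\in\{\pm1\}$, and, given the labels, each pair of distinct vertices $u,v$ is joined by an edge of the graph $G$ independently, with probability $p_n$ if $\sigma_u=\sigma_v$ and $q_n$ if $\sigma_u\neq\sigma_v$. For labelings $\sigma,\tau\in\{\pm1\}^n$ let \[ \mathrm{ov}(\sigma,\tau)=\frac1n\Bigl(\sum_{i=1}^n\sigma_i\tau_i-\frac1n\Bigl(\sum_{i=1}^n\sigma_i\Bigr)\Bigl(\sum_{i=1}^n\tau_i\Bigr)\Bigr). \] A labeling estimate is a (possibly randomized) map that assigns to every graph $G$ on $n$ vertices a labeling $\hat\sigma=\hat\sigma(G)\in\{\pm1\}^n$; it sees only $G$ and its own independent randomness, and may depend on $n,a_n,b_n$. (i) Suppose $a_n\to\infty$, $b_n\to\infty$, $a_n=o(n)$, and $(a_n-b_n)^2<2(a_n+b_n)$ for all sufficiently large $n$. Then for every sequence of labeling estimates, $\mathrm{ov}(\sigma,\hat\sigma)\to0$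 in probability as $n\to\infty$. (ii) Suppose $a_n/n\to p\in(0,1)$ and $c_n:=(a_n-b_n)^2/(a_n+b_n)$ satisfies $\frac{c_n}{2(1-p)}<1$ for all sufficiently large $n$. Then for every sequence of labeling estimates, $\mathrm{ov}(\sigma,\hat\sigma)\to0$ in probability as $n\to\infty$. Thus in both regimes no reconstruction algorithm does asymptotically better than random guessing. -/

import Mathlib

open Filter Topology Asymptotics

/-- A `±1`-labeling of the vertices `0, …, n - 1`. -/
abbrev Labeling (n : ℕ) : Type := Fin n → ℤˣ

namespace SBM

noncomputable section

/-- The unordered pairs of distinct vertices, each one listed once. -/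
def pairs (n : ℕ) : Finset (Fin n × Fin n) :=
  Finset.univ.filter fun e => e.1 < e.2

/-- The probability of an edge between `u` and `v` given the labels: `p` if the labels agree,
`q` if they differ. -/
def edgeProb {n : ℕ} (p q : unitInterval) (σ : Labeling n) (u v : Fin n) : ℝ :=
  if σ u = σ v then (p : ℝ) else (q : ℝ)

open Classical in
/-- The conditional probability of the graph `G` given the labeling `σ`: edges are present
independently, with the probabilities `edgeProb`. -/
def graphProb {n : ℕ} (p q : unitInterval) (σ : Labeling n) (G : SimpleGraph (Fin n)) : ℝ :=
  ∏ e ∈ pairs n, if G.Adj e.1 e.2 then edgeProb p q σ e.1 e.2 else 1 - edgeProb p q σ e.1 e.2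

/-- The joint probability of the labeling `σ` (uniform on all `2 ^ n` labelings) and the
graph `G`. -/
def mass {n : ℕ} (p q : unitInterval) (x : Labeling n × SimpleGraph (Fin n)) : ℝ :=
  (1 / 2 : ℝ) ^ n * graphProb p q x.1 x.2

theorem edgeProb_mem {n : ℕ} (p q : unitInterval) (σ : Labeling n) (u v : Fin n) :
    0 ≤ edgeProb p q σ u v ∧ edgeProb p q σ u v ≤ 1 := by
  unfold edgeProb
  split_ifs
  · exact p.2
  · exact q.2

theorem graphProb_nonneg {n : ℕ} (p q : unitInterval) (σ : Labeling n)
    (G : SimpleGraph (Fin n)) : 0 ≤ graphProb p q σ G := by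
  classical
  unfold graphProb
  refine Finset.prod_nonneg fun e _ => ?_
  have h := edgeProb_mem p q σ e.1 e.2
  split_ifs
  · exact h.1
  · linarith [h.2]

theorem mass_nonneg {n : ℕ} (p q : unitInterval) (x : Labeling n × SimpleGraph (Fin n)) :
    0 ≤ mass p q x :=
  mul_nonneg (by positivity) (graphProb_nonneg p q x.1 x.2)

theorem sum_graphProb {n : ℕ} (p q : unitInterval) (σ : Labeling n) :
    ∑ G : SimpleGraph (Fin n), graphProb p q σ G = 1 := by
  classical
  have h := Finset.prod_add (fun e : Fin n × Fin n => edgeProb p q σ e.1 e.2)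
    (fun e => 1 - edgeProb p q σ e.1 e.2) (pairs n)
  have h1 : ∏ e ∈ pairs n, (edgeProb p q σ e.1 e.2 + (1 - edgeProb p q σ e.1 e.2)) = 1 :=
    Finset.prod_eq_one fun e _ => by ring
  rw [h1] at h
  rw [h]
  refine Finset.sum_bij' (fun G _ => (pairs n).filter fun e => G.Adj e.1 e.2)
    (fun t _ => SimpleGraph.fromRel fun u v => (u, v) ∈ t)
    (fun G _ => by simp) (fun _ _ => Finset.mem_univ _) ?_ ?_ ?_
  · intro G _
    ext u v
    simp only [SimpleGraph.fromRel_adj, Finset.mem_filter, pairs, Finset.mem_univ, true_and]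
    constructor
    · rintro ⟨_, h | h⟩
      · exact h.2
      · exact h.2.symm
    · intro h
      refine ⟨h.ne, ?_⟩
      rcases lt_or_gt_of_ne h.ne with h' | h'
      · exact Or.inl ⟨h', h⟩
      · exact Or.inr ⟨h', h.symm⟩
  · intro t ht
    have ht' := Finset.mem_powerset.1 ht
    ext ⟨u, v⟩
    simp only [SimpleGraph.fromRel_adj, Finset.mem_filter]
    constructor
    · rintro ⟨h, _, h' | h'⟩
      · exact h'
      · have h2 := ht' h'
        simp only [pairs, Finset.mem_filter, Finset.mem_univ, true_and] at h h2
        exact absurd h (lt_asymm h2)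
    · intro h
      have h2 := ht' h
      refine ⟨h2, ?_, Or.inl h⟩
      simp only [pairs, Finset.mem_filter, Finset.mem_univ, true_and] at h2
      exact h2.ne
  · intro G _
    unfold graphProb
    rw [Finset.prod_ite, Finset.filter_not]

theorem sum_mass {n : ℕ} (p q : unitInterval) :
    ∑ x : Labeling n × SimpleGraph (Fin n), mass p q x = 1 := by
  rw [Fintype.sum_prod_type]
  simp only [mass, ← Finset.mul_sum, sum_graphProb]
  simp

/-- The planted partition model `𝒢(n, p, q)`: the joint law of the true labeling and of the
random graph. -/
def model (n : ℕ) (p q : unitInterval) : PMF (Labeling n × SimpleGraph (Fin n)) :=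
  PMF.ofFintype (fun x => ENNReal.ofReal (mass p q x)) (by
    rw [← ENNReal.ofReal_sum_of_nonneg fun x _ => mass_nonneg p q x, sum_mass,
      ENNReal.ofReal_one])

/-- The overlap of two labelings. -/
def overlap {n : ℕ} (σ τ : Labeling n) : ℝ :=
  1 / (n : ℝ) * (∑ i, ((σ i : ℤ) : ℝ) * ((τ i : ℤ) : ℝ)
    - 1 / (n : ℝ) * (∑ i, ((σ i : ℤ) : ℝ)) * (∑ i, ((τ i : ℤ) : ℝ)))

/-- A labeling estimate, for graphs with `n` vertices: it sees only the graph, and may use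
additional randomness, so it assigns to each graph the law of a labeling. A deterministic
estimate `f` is `fun G => PMF.pure (f G)`. -/
abbrev Estimate (n : ℕ) : Type := SimpleGraph (Fin n) → PMF (Labeling n)

/-- The law of the overlap of the true labeling with its estimate, when the labeled graph is
drawn from `𝒢(n, p, q)` and the estimate is computed from the graph. -/
def overlapLaw {n : ℕ} (p q : unitInterval) (est : Estimate n) : PMF ℝ :=
  (model n p q).bind fun x => (est x.2).map fun τ => overlap x.1 τ

/-- A sequence of laws on `ℝ` converges to `0` in probability. -/
def TendstoZeroInProbability (μ : ℕ → PMF ℝ) : Prop :=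
  ∀ ε : ℝ, 0 < ε → Tendsto (fun n => (μ n).toMeasure {x : ℝ | ε ≤ |x|}) atTop (𝓝 0)

end

end SBM

/-! Compare the planted model with the Erdős–Rényi graph of edge probability `m = (p + q) / 2`. For
two labelings with inner product `S`, the product of their likelihood ratios has mean at most `exp
(t * S ^ 2 / (2 * n))` (`sum_graphProb_mul_div_le`), where `t ≤ 1 + κ` near the threshold. Averaged
over labelings this is a Curie–Weiss partition function at temperature close to critical; the
quartic term of `log cosh` keeps its exponential rate quadratically small in the distance to
criticality (`sum_exp_sq_sum_signs_le`).

There is thus room for a tilt `exp (κ / n * S ^ 2)`: the exponential rate stays `O(κ ^ 2)`. The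
variational principle (`sum_replicaSum_le`) converts this into a bound `O(κ) + log (2 * n + 1) / (n
* κ)` on the mean of `(S / n) ^ 2` for two posterior samples. Since `κ` is arbitrary, independent
posterior samples are asymptotically orthogonal. Given the graph, an estimate is independent of the
true labeling, so Cauchy–Schwarz (`sq_sum_mul_sq_le`) bounds its mean square overlap by this replica
quantity, and Chebyshev's inequality concludes. -/

/-! ### Pair sums, the hyperbolic cosine and the Curie–Weiss model -/

open Finset in
theorem SBM.sum_pairs_mul_le_half_sq {n : ℕ} (x : Fin n → ℝ) :
    ∑ e ∈ SBM.pairs n, x e.1 * x e.2 ≤ (∑ i, x i) ^ 2 / 2 := by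
  have h1 : (∑ i, x i) ^ 2 = ∑ e : Fin n × Fin n, x e.1 * x e.2 := by
    rw [sq, Finset.sum_mul_sum, Fintype.sum_prod_type]
  have h2 : ∑ e : Fin n × Fin n, x e.1 * x e.2
      = ∑ e ∈ SBM.pairs n, x e.1 * x e.2
        + ∑ e ∈ univ.filter (fun e : Fin n × Fin n => ¬ e.1 < e.2), x e.1 * x e.2 :=
    (Finset.sum_filter_add_sum_filter_not univ (fun e : Fin n × Fin n => e.1 < e.2) _).symm
  have h3 : ∑ e ∈ univ.filter (fun e : Fin n × Fin n => ¬ e.1 < e.2), x e.1 * x e.2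
      = ∑ e ∈ univ.filter (fun e : Fin n × Fin n => e.2 < e.1), x e.1 * x e.2
        + ∑ e ∈ univ.filter (fun e : Fin n × Fin n => e.1 = e.2), x e.1 * x e.2 := by
    rw [← Finset.sum_filter_add_sum_filter_not (univ.filter
      (fun e : Fin n × Fin n => ¬ e.1 < e.2)) (fun e : Fin n × Fin n => e.2 < e.1),
      Finset.filter_filter, Finset.filter_filter]
    congr 2
    · ext e
      simp only [mem_filter, mem_univ, true_and]
      exact ⟨fun h => h.2, fun h => ⟨h.not_gt, h⟩⟩
    · ext e
      simp only [mem_filter, mem_univ, true_and, not_lt]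
      exact ⟨fun h => le_antisymm h.2 h.1, fun h => ⟨h.ge, h.le⟩⟩
  have h4 : ∑ e ∈ univ.filter (fun e : Fin n × Fin n => e.2 < e.1), x e.1 * x e.2
      = ∑ e ∈ SBM.pairs n, x e.1 * x e.2 := by
    refine Finset.sum_nbij' Prod.swap Prod.swap ?_ ?_ ?_ ?_ ?_
    · simp [SBM.pairs]
    · simp [SBM.pairs]
    · simp
    · simp
    · intro e _
      simp [mul_comm]
  have h5 : 0 ≤ ∑ e ∈ univ.filter (fun e : Fin n × Fin n => e.1 = e.2), x e.1 * x e.2 := by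
    refine Finset.sum_nonneg fun e he => ?_
    rw [(mem_filter.1 he).2]
    exact mul_self_nonneg _
  linarith

/-- `cosh r ≤ exp (r ^ 2 / 2)` with the next term of the expansion. -/
theorem Real.cosh_le_exp_sq_sub_pow_four {r : ℝ} (hr : |r| ≤ 1) :
    Real.cosh r ≤ Real.exp (r ^ 2 / 2 - r ^ 4 / 24) := by
  have h1 := (abs_le.1 (Real.exp_bound hr (n := 4) (by norm_num))).2
  have h2 := (abs_le.1 (Real.exp_bound (x := -r) (by rwa [abs_neg]) (n := 4) (by norm_num))).2
  have h4 : |r| ^ 4 = r ^ 4 := by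
    rw [show (4 : ℕ) = 2 * 2 from rfl, pow_mul, sq_abs, ← pow_mul]
  simp only [Finset.sum_range_succ, Finset.sum_range_zero, Nat.factorial, abs_neg, h4] at h1 h2
  norm_num at h1 h2
  have hy : r ^ 2 ≤ 1 := by
    rw [← sq_abs]
    exact pow_le_one₀ (abs_nonneg r) hr
  have hx : 0 ≤ r ^ 2 / 2 - r ^ 4 / 24 := by nlinarith [sq_nonneg r]
  have h3 := Real.quadratic_le_exp_of_nonneg hx
  have h6 : r ^ 6 ≤ r ^ 4 := by nlinarith [pow_nonneg (sq_nonneg r) 2]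
  rw [Real.cosh_eq]
  nlinarith [pow_nonneg (sq_nonneg r) 2, pow_nonneg (sq_nonneg r) 4]

theorem sq_intUnits_cast (u : ℤˣ) : ((u : ℤ) : ℝ) ^ 2 = 1 := by
  rcases Int.units_eq_one_or u with rfl | rfl <;> simp

/-- The moment generating function of a sum of `n` independent random signs. -/
theorem sum_exp_mul_sum_signs (n : ℕ) (r : ℝ) :
    ∑ x : Labeling n, (1 / 2 : ℝ) ^ n * Real.exp (r * ∑ i, ((x i : ℤ) : ℝ)) = Real.cosh r ^ n := by
  have h : ∀ x : Labeling n, (1 / 2 : ℝ) ^ n * Real.exp (r * ∑ i, ((x i : ℤ) : ℝ))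
      = ∏ i, (1 / 2 * Real.exp (r * ((x i : ℤ) : ℝ))) := by
    intro x
    rw [Finset.prod_mul_distrib, Finset.prod_const, Finset.mul_sum, Real.exp_sum]
    simp
  simp_rw [h]
  rw [← Fintype.piFinset_univ, ← Finset.prod_univ_sum (fun _ => (Finset.univ : Finset ℤˣ))
    (fun _ u => 1 / 2 * Real.exp (r * ((u : ℤ) : ℝ))), Finset.prod_const, Finset.card_univ,
    Fintype.card_fin]
  congr 1
  rw [Real.cosh_eq, show (Finset.univ : Finset ℤˣ) = {1, -1} from rfl,
    Finset.sum_insert (by decide), Finset.sum_singleton]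
  simp
  ring

/-- The Curie–Weiss partition function close to the critical temperature. -/
theorem sum_exp_sq_sum_signs_le {n : ℕ} (hn : 0 < n) (η : ℝ) :
    ∑ x : Labeling n, (1 / 2 : ℝ) ^ n
        * Real.exp ((1 + η) * (∑ i, ((x i : ℤ) : ℝ)) ^ 2 / (2 * n))
      ≤ (2 * n + 1) * Real.exp (n * (3 / 2 * η ^ 2)) := by
  have hn' : (0 : ℝ) < n := by exact_mod_cast hn
  let K : Finset ℤ := Finset.Icc (-(n : ℤ)) n
  -- A discrete Hubbard–Stratonovich linearization: the spin sum is an integer in `K`, and the term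
  -- with `k` equal to it is exactly the left side. Only `2 * n + 1` terms are added.
  have hpt : ∀ x : Labeling n, Real.exp ((1 + η) * (∑ i, ((x i : ℤ) : ℝ)) ^ 2 / (2 * n))
      ≤ ∑ k ∈ K, Real.exp ((1 + η) * (k : ℝ) ^ 2 / (2 * n) - (k : ℝ) ^ 2 / n)
          * Real.exp ((k : ℝ) / n * ∑ i, ((x i : ℤ) : ℝ)) := by
    intro x
    have hk : (∑ i, (x i : ℤ)) ∈ K := by
      rw [Finset.mem_Icc, ← abs_le]
      refine (Finset.abs_sum_le_sum_abs _ _).trans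
        ((Finset.sum_le_card_nsmul _ _ 1 fun i _ => ?_).trans (by simp))
      rcases Int.units_eq_one_or (x i) with h | h <;> simp [h]
    have hs := Finset.single_le_sum (f := fun k : ℤ =>
      Real.exp ((1 + η) * (k : ℝ) ^ 2 / (2 * n) - (k : ℝ) ^ 2 / n)
          * Real.exp ((k : ℝ) / n * ∑ i, ((x i : ℤ) : ℝ))) (fun k _ => by positivity) hk
    refine le_trans (le_of_eq ?_) hs
    rw [← Real.exp_add]
    push_cast
    congr 1
    ring
  calc _ ≤ ∑ x : Labeling n, (1 / 2 : ℝ) ^ n * ∑ k ∈ K,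
            Real.exp ((1 + η) * (k : ℝ) ^ 2 / (2 * n) - (k : ℝ) ^ 2 / n)
            * Real.exp ((k : ℝ) / n * ∑ i, ((x i : ℤ) : ℝ)) :=
        Finset.sum_le_sum fun x _ => mul_le_mul_of_nonneg_left (hpt x) (by positivity)
    _ = ∑ k ∈ K, Real.exp ((1 + η) * (k : ℝ) ^ 2 / (2 * n) - (k : ℝ) ^ 2 / n)
            * Real.cosh ((k : ℝ) / n) ^ n := by
        simp_rw [← sum_exp_mul_sum_signs, Finset.mul_sum]
        rw [Finset.sum_comm]
        refine Finset.sum_congr rfl fun k _ => Finset.sum_congr rfl fun x _ => ?_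
        rw [← Finset.mul_sum]
        ring
    _ ≤ ∑ k ∈ K, Real.exp (n * (3 / 2 * η ^ 2)) := by
        refine Finset.sum_le_sum fun k hk => ?_
        have hr : |(k : ℝ) / n| ≤ 1 := by
          rw [abs_div, abs_of_pos hn', div_le_one hn']
          exact_mod_cast abs_le.2 (Finset.mem_Icc.1 hk)
        set r : ℝ := (k : ℝ) / n with hrdef
        have hkr : (k : ℝ) = r * n := by rw [hrdef]; field_simp
        refine (mul_le_mul_of_nonneg_left (pow_le_pow_left₀ (Real.cosh_pos r).le
          (Real.cosh_le_exp_sq_sub_pow_four hr) n) (Real.exp_pos _).le).trans ?_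
        rw [← Real.exp_nat_mul, ← Real.exp_add]
        refine Real.exp_le_exp.2 ?_
        have e : (1 + η) * (k : ℝ) ^ 2 / (2 * n) - (k : ℝ) ^ 2 / n + n * (r ^ 2 / 2 - r ^ 4 / 24)
            = n * (η * r ^ 2 / 2 - r ^ 4 / 24) := by
          rw [hkr]
          field_simp
          ring
        rw [e]
        refine mul_le_mul_of_nonneg_left ?_ hn'.le
        -- Maximizing over `r ^ 2`, with the optimum at `6 * η`, gives the rate `3 / 2 * η ^ 2`.
        nlinarith [sq_nonneg (r ^ 2 - 6 * η)]
    _ = _ := by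
        rw [Finset.sum_const, Int.card_Icc, nsmul_eq_mul]
        congr 1
        have : ((n : ℤ) + 1 - -(n : ℤ)).toNat = 2 * n + 1 := by omega
        rw [this]
        push_cast
        ring

/-! ### Likelihood ratios against the Erdős–Rényi graph -/

namespace SBM

-- Expanding the product over pairs chooses, for each pair, whether it is an edge; such choices are
-- exactly the graphs.
open Classical in
theorem sum_prod_adj {n : ℕ} (f g : Fin n × Fin n → ℝ) :
    ∑ G : SimpleGraph (Fin n), ∏ e ∈ pairs n, (if G.Adj e.1 e.2 then f e else g e)
      = ∏ e ∈ pairs n, (f e + g e) := by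
  rw [Finset.prod_add]
  refine Finset.sum_bij' (fun G _ => (pairs n).filter fun e => G.Adj e.1 e.2)
    (fun t _ => SimpleGraph.fromRel fun u v => (u, v) ∈ t)
    (fun G _ => by simp) (fun _ _ => Finset.mem_univ _) ?_ ?_ ?_
  · intro G _
    ext u v
    simp only [SimpleGraph.fromRel_adj, Finset.mem_filter, pairs, Finset.mem_univ, true_and]
    constructor
    · rintro ⟨_, h | h⟩
      · exact h.2
      · exact h.2.symm
    · intro h
      refine ⟨h.ne, ?_⟩
      rcases lt_or_gt_of_ne h.ne with h' | h'
      · exact Or.inl ⟨h', h⟩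
      · exact Or.inr ⟨h', h.symm⟩
  · intro t ht
    have ht' := Finset.mem_powerset.1 ht
    ext ⟨u, v⟩
    simp only [SimpleGraph.fromRel_adj, Finset.mem_filter]
    constructor
    · rintro ⟨h, _, h' | h'⟩
      · exact h'
      · have h2 := ht' h'
        simp only [pairs, Finset.mem_filter, Finset.mem_univ, true_and] at h h2
        exact absurd h (lt_asymm h2)
    · intro h
      have h2 := ht' h
      refine ⟨h2, ?_, Or.inl h⟩
      simp only [pairs, Finset.mem_filter, Finset.mem_univ, true_and] at h2
      exact h2.ne
  · intro G _
    rw [Finset.prod_ite, Finset.filter_not]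

noncomputable section

open Classical in
/-- The probability of the graph `G` in the Erdős–Rényi model with edge probability `m`. -/
def erdosRenyiProb {n : ℕ} (m : ℝ) (G : SimpleGraph (Fin n)) : ℝ :=
  ∏ e ∈ pairs n, if G.Adj e.1 e.2 then m else 1 - m

theorem erdosRenyiProb_pos {n : ℕ} {m : ℝ} (h0 : 0 < m) (h1 : m < 1) (G : SimpleGraph (Fin n)) :
    0 < erdosRenyiProb m G := by
  classical
  refine Finset.prod_pos fun e _ => ?_
  split_ifs
  · exact h0
  · linarith

theorem sum_erdosRenyiProb {n : ℕ} (m : ℝ) :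
    ∑ G : SimpleGraph (Fin n), erdosRenyiProb m G = 1 := by
  unfold erdosRenyiProb
  rw [sum_prod_adj (fun _ => m) (fun _ => 1 - m)]
  exact Finset.prod_eq_one fun _ _ => by ring

/-- The inner product of two labelings. -/
def agreement {n : ℕ} (σ τ : Labeling n) : ℝ := ∑ i, ((σ i : ℤ) : ℝ) * ((τ i : ℤ) : ℝ)

theorem edgeProb_eq {n : ℕ} (p q : unitInterval) (σ : Labeling n) (u v : Fin n) :
    edgeProb p q σ u v = ((p : ℝ) + q) / 2
      + ((p : ℝ) - q) / 2 * (((σ u : ℤ) : ℝ) * ((σ v : ℤ) : ℝ)) := by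
  unfold edgeProb
  rcases Int.units_eq_one_or (σ u) with hu | hu <;> rcases Int.units_eq_one_or (σ v) with hv | hv <;>
    rw [hu, hv]
  · simp; ring
  · rw [if_neg (by decide)]; simp; ring
  · rw [if_neg (by decide)]; simp; ring
  · simp; ring

/-- The inner product of the likelihood ratios of two labelings. -/
theorem sum_graphProb_mul_div_le {n : ℕ} (hn : 0 < n) {p q : unitInterval} {m t : ℝ}
    (hm : m = ((p : ℝ) + q) / 2) (h0 : 0 < m) (h1 : m < 1)
    (ht : n * (((p : ℝ) - q) / 2) ^ 2 ≤ t * (m * (1 - m))) (σ τ : Labeling n) :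
    ∑ G, graphProb p q σ G * graphProb p q τ G / erdosRenyiProb m G
      ≤ Real.exp (t * agreement σ τ ^ 2 / (2 * n)) := by
  classical
  have hn' : (0 : ℝ) < n := by exact_mod_cast hn
  have h1' : 0 < 1 - m := by linarith
  set d : ℝ := ((p : ℝ) - q) / 2 with hd
  have e1 : ∀ G : SimpleGraph (Fin n),
      graphProb p q σ G * graphProb p q τ G / erdosRenyiProb m G
      = ∏ e ∈ pairs n, if G.Adj e.1 e.2 then edgeProb p q σ e.1 e.2 * edgeProb p q τ e.1 e.2 / m
          else (1 - edgeProb p q σ e.1 e.2) * (1 - edgeProb p q τ e.1 e.2) / (1 - m) := by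
    intro G
    unfold graphProb erdosRenyiProb
    rw [← Finset.prod_mul_distrib, ← Finset.prod_div_distrib]
    refine Finset.prod_congr rfl fun e _ => ?_
    split_ifs <;> rfl
  simp_rw [e1]
  rw [sum_prod_adj (fun e => edgeProb p q σ e.1 e.2 * edgeProb p q τ e.1 e.2 / m)
    (fun e => (1 - edgeProb p q σ e.1 e.2) * (1 - edgeProb p q τ e.1 e.2) / (1 - m))]
  let x : Fin n → ℝ := fun i => ((σ i : ℤ) : ℝ) * ((τ i : ℤ) : ℝ)
  let c : ℝ := d ^ 2 / (m * (1 - m))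
  have hc0 : 0 ≤ c := by positivity
  have hc : c ≤ t / n := by
    rw [div_le_div_iff₀ (by positivity) hn']
    linarith
  have hfac : ∀ e ∈ pairs n, edgeProb p q σ e.1 e.2 * edgeProb p q τ e.1 e.2 / m
      + (1 - edgeProb p q σ e.1 e.2) * (1 - edgeProb p q τ e.1 e.2) / (1 - m)
      ≤ Real.exp (c * (x e.1 * x e.2)) := by
    intro e _
    -- With edge probabilities `m ± d`, the terms linear in `d` cancel between edge and non-edge.
    have : edgeProb p q σ e.1 e.2 * edgeProb p q τ e.1 e.2 / m
      + (1 - edgeProb p q σ e.1 e.2) * (1 - edgeProb p q τ e.1 e.2) / (1 - m)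
      = c * (x e.1 * x e.2) + 1 := by
      simp only [edgeProb_eq, ← hm, ← hd, c, x]
      field_simp
      ring
    rw [this]
    exact Real.add_one_le_exp _
  refine (Finset.prod_le_prod (fun e _ => ?_) hfac).trans ?_
  · have hσ := edgeProb_mem p q σ e.1 e.2
    have hτ := edgeProb_mem p q τ e.1 e.2
    have a1 := mul_nonneg hσ.1 hτ.1
    have a2 := mul_nonneg (sub_nonneg.2 hσ.2) (sub_nonneg.2 hτ.2)
    positivity
  rw [← Real.exp_sum, ← Finset.mul_sum]
  refine Real.exp_le_exp.2 ?_
  have hx := SBM.sum_pairs_mul_le_half_sq x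
  calc c * ∑ e ∈ pairs n, x e.1 * x e.2 ≤ c * ((∑ i, x i) ^ 2 / 2) :=
        mul_le_mul_of_nonneg_left hx hc0
    _ ≤ t / n * ((∑ i, x i) ^ 2 / 2) := mul_le_mul_of_nonneg_right hc (by positivity)
    _ = _ := by
        simp only [agreement, x]
        field_simp

/-! ### Two replicas of the posterior law -/

/-- The probability of the graph `G` in the planted partition model. -/
def marginal {n : ℕ} (p q : unitInterval) (G : SimpleGraph (Fin n)) : ℝ :=
  ∑ σ : Labeling n, mass p q (σ, G)

theorem marginal_nonneg {n : ℕ} (p q : unitInterval) (G : SimpleGraph (Fin n)) :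
    0 ≤ marginal p q G :=
  Finset.sum_nonneg fun _ _ => mass_nonneg p q _

theorem sum_marginal {n : ℕ} (p q : unitInterval) :
    ∑ G : SimpleGraph (Fin n), marginal p q G = 1 := by
  rw [← sum_mass p q, Fintype.sum_prod_type, Finset.sum_comm]
  rfl

/-- The expectation, given the graph `G`, of `f` at two independent samples of the posterior law
of the labeling, times the probability of `G`. -/
def replicaSum {n : ℕ} (p q : unitInterval) (f : Labeling n → Labeling n → ℝ)
    (G : SimpleGraph (Fin n)) : ℝ :=
  (∑ σ, ∑ τ, mass p q (σ, G) * mass p q (τ, G) * f σ τ) / marginal p q G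

/-- Gibbs' variational principle and Jensen's inequality for the posterior law. -/
theorem sum_replicaSum_le {n : ℕ} (p q : unitInterval) {m B : ℝ} (h0 : 0 < m) (h1 : m < 1)
    (hB : 0 < B) (f : Labeling n → Labeling n → ℝ)
    (h : ∑ σ : Labeling n, ∑ τ : Labeling n, (1 / 2 : ℝ) ^ n * (1 / 2 : ℝ) ^ n * Real.exp (f σ τ)
      * ∑ G, graphProb p q σ G * graphProb p q τ G / erdosRenyiProb m G ≤ B) :
    ∑ G, replicaSum p q f G ≤ Real.log B := by
  have key : ∀ G, replicaSum p q f G ≤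
      (∑ σ, ∑ τ, mass p q (σ, G) * mass p q (τ, G) * Real.exp (f σ τ) / erdosRenyiProb m G) / B
        - 2 * marginal p q G + marginal p q G * Real.log B + erdosRenyiProb m G := by
    intro G
    have hQ := erdosRenyiProb_pos h0 h1 G
    have hS : 0 ≤ ∑ σ, ∑ τ, mass p q (σ, G) * mass p q (τ, G) * Real.exp (f σ τ)
        / erdosRenyiProb m G := by
      refine Finset.sum_nonneg fun σ _ => Finset.sum_nonneg fun τ _ => ?_
      have := mass_nonneg p q (σ, G)
      have := mass_nonneg p q (τ, G)
      positivity
    unfold replicaSum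
    rcases (marginal_nonneg p q G).eq_or_lt with hM | hM
    · rw [← hM, div_zero]
      have := div_nonneg hS hB.le
      linarith
    set M := marginal p q G with hMdef
    set Q := erdosRenyiProb m G with hQdef
    -- The inequality `f ≤ exp (f - c) + c - 1` replaces the logarithm of the tilted mean by a
    -- linear bound; this `c` makes the exponential terms sum over graphs to at most `1`.
    let c : ℝ := Real.log (B * Q / M)
    have hc : Real.exp (-c) = M / (B * Q) := by
      rw [Real.exp_neg, Real.exp_log (by positivity), inv_div]
    have hcle : M * c ≤ M * Real.log B + (Q - M) := by
      have e : c = Real.log B + Real.log (Q / M) := by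
        rw [← Real.log_mul (by positivity) (by positivity)]
        simp only [c]
        congr 1
        ring
      -- Summed over graphs, this is the nonnegativity of the relative entropy of the planted law
      -- with respect to the Erdős–Rényi law.
      have l := Real.log_le_sub_one_of_pos (div_pos hQ hM)
      have l2 := mul_le_mul_of_nonneg_left l hM.le
      have : M * (Q / M - 1) = Q - M := by field_simp
      rw [e, mul_add]
      linarith
    have hpt : ∀ σ τ, mass p q (σ, G) * mass p q (τ, G) * f σ τ
        ≤ mass p q (σ, G) * mass p q (τ, G) * Real.exp (f σ τ) / Q * (M / B)
          + mass p q (σ, G) * mass p q (τ, G) * (c - 1) := by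
      intro σ τ
      have hw := mul_nonneg (mass_nonneg p q (σ, G)) (mass_nonneg p q (τ, G))
      have l := Real.add_one_le_exp (f σ τ - c)
      rw [sub_eq_add_neg, Real.exp_add, hc] at l
      have l2 := mul_le_mul_of_nonneg_left l hw
      have : mass p q (σ, G) * mass p q (τ, G) * (Real.exp (f σ τ) * (M / (B * Q)))
        = mass p q (σ, G) * mass p q (τ, G) * Real.exp (f σ τ) / Q * (M / B) := by
        field_simp
      rw [this] at l2
      linarith
    have hMM : ∑ σ, ∑ τ, mass p q (σ, G) * mass p q (τ, G) * (c - 1) = M * M * (c - 1) := by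
      simp_rw [← Finset.sum_mul, ← Finset.mul_sum, ← Finset.sum_mul]
      rfl
    rw [div_le_iff₀ hM]
    calc _ ≤ ∑ σ, ∑ τ, (mass p q (σ, G) * mass p q (τ, G) * Real.exp (f σ τ) / Q * (M / B)
          + mass p q (σ, G) * mass p q (τ, G) * (c - 1)) :=
          Finset.sum_le_sum fun σ _ => Finset.sum_le_sum fun τ _ => hpt σ τ
      _ = (∑ σ, ∑ τ, mass p q (σ, G) * mass p q (τ, G) * Real.exp (f σ τ) / Q) * (M / B)
          + M * M * (c - 1) := by
          simp_rw [Finset.sum_add_distrib]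
          rw [hMM]
          simp_rw [← Finset.sum_mul]
      _ = ((∑ σ, ∑ τ, mass p q (σ, G) * mass p q (τ, G) * Real.exp (f σ τ) / Q) / B
          + (M * c - M)) * M := by ring
      _ ≤ _ := mul_le_mul_of_nonneg_right (by linarith) hM.le
  refine (Finset.sum_le_sum fun G _ => key G).trans ?_
  rw [Finset.sum_add_distrib, Finset.sum_add_distrib, Finset.sum_sub_distrib, ← Finset.mul_sum,
    ← Finset.sum_mul, ← Finset.sum_div, sum_marginal, sum_erdosRenyiProb]
  have hle : (∑ G, ∑ σ, ∑ τ, mass p q (σ, G) * mass p q (τ, G) * Real.exp (f σ τ)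
      / erdosRenyiProb m G) / B ≤ 1 := by
    rw [div_le_one hB]
    refine le_trans (le_of_eq ?_) h
    rw [Finset.sum_comm]
    refine Finset.sum_congr rfl fun σ _ => ?_
    rw [Finset.sum_comm]
    refine Finset.sum_congr rfl fun τ _ => ?_
    rw [Finset.mul_sum]
    refine Finset.sum_congr rfl fun G _ => ?_
    simp only [mass]
    ring
  linarith

theorem sum_sum_agreement {n : ℕ} (F : ℝ → ℝ) :
    ∑ σ : Labeling n, ∑ τ : Labeling n, (1 / 2 : ℝ) ^ n * (1 / 2 : ℝ) ^ n * F (agreement σ τ)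
      = ∑ x : Labeling n, (1 / 2 : ℝ) ^ n * F (∑ i, ((x i : ℤ) : ℝ)) := by
  have h : ∀ σ : Labeling n, ∑ τ : Labeling n, F (agreement σ τ)
      = ∑ x : Labeling n, F (∑ i, ((x i : ℤ) : ℝ)) := by
    intro σ
    -- The inner product of `σ` and `τ` is the spin sum of `σ * τ`, which is uniform when `τ` is.
    refine Fintype.sum_equiv (Equiv.mulLeft σ) _ _ fun τ => ?_
    simp [agreement]
  simp_rw [mul_assoc, ← Finset.mul_sum, h]
  simp

/-- Two samples of the posterior law of the labeling are nearly orthogonal, close to the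
threshold. -/
theorem sum_replicaSum_agreement_le {n : ℕ} (hn : 0 < n) {p q : unitInterval} {m κ : ℝ}
    (hm : m = ((p : ℝ) + q) / 2) (h0 : 0 < m) (h1 : m < 1) (hκ : 0 < κ)
    (ht : n * (((p : ℝ) - q) / 2) ^ 2 ≤ (1 + κ) * (m * (1 - m))) :
    ∑ G : SimpleGraph (Fin n), replicaSum p q (fun σ τ => agreement σ τ ^ 2) G / n ^ 2
      ≤ Real.log (2 * n + 1) / n / κ + 27 / 2 * κ := by
  have hn' : (0 : ℝ) < n := by exact_mod_cast hn
  have h := sum_replicaSum_le p q h0 h1 (B := (2 * n + 1) * Real.exp (n * (3 / 2 * (3 * κ) ^ 2)))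
    -- In units of `S ^ 2 / (2 * n)` this tilt is `2 * κ`; with the `1 + κ` of the likelihood ratio
    -- it gives the parameter `3 * κ`.
    (by positivity) (fun σ τ : Labeling n => κ / n * agreement σ τ ^ 2) (by
      refine le_trans ?_ (sum_exp_sq_sum_signs_le hn (3 * κ))
      rw [← sum_sum_agreement (fun S => Real.exp ((1 + 3 * κ) * S ^ 2 / (2 * n)))]
      refine Finset.sum_le_sum fun σ _ => Finset.sum_le_sum fun τ _ => ?_
      rw [mul_assoc]
      refine mul_le_mul_of_nonneg_left ?_ (by positivity)
      refine (mul_le_mul_of_nonneg_left (sum_graphProb_mul_div_le hn hm h0 h1 ht σ τ)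
        (Real.exp_pos _).le).trans ?_
      rw [← Real.exp_add]
      refine le_of_eq (congrArg _ ?_)
      field_simp
      ring)
  rw [Real.log_mul (by positivity) (by positivity), Real.log_exp] at h
  have e : ∑ G : SimpleGraph (Fin n), replicaSum p q (fun σ τ => agreement σ τ ^ 2) G / n ^ 2
      = (∑ G : SimpleGraph (Fin n), replicaSum p q (fun σ τ => κ / n * agreement σ τ ^ 2) G)
        / (κ * n) := by
    rw [Finset.sum_div]
    refine Finset.sum_congr rfl fun G _ => ?_
    have : ∑ σ : Labeling n, ∑ τ : Labeling n,
        mass p q (σ, G) * mass p q (τ, G) * (κ / n * agreement σ τ ^ 2)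
        = κ / n * ∑ σ : Labeling n, ∑ τ : Labeling n,
          mass p q (σ, G) * mass p q (τ, G) * agreement σ τ ^ 2 := by
      simp_rw [Finset.mul_sum]
      exact Finset.sum_congr rfl fun σ _ => Finset.sum_congr rfl fun τ _ => by ring
    simp only [replicaSum, this]
    field_simp
  rw [e, div_le_iff₀ (by positivity)]
  refine h.trans (le_of_eq ?_)
  field_simp
  ring

/-! ### From replicas to the overlap of an estimate -/

/-- For a fixed estimate, the overlap is a linear functional of the true labeling. -/
theorem overlap_eq {n : ℕ} (σ τ : Labeling n) :
    overlap σ τ = 1 / n * ∑ i, ((σ i : ℤ) : ℝ)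
      * (((τ i : ℤ) : ℝ) - 1 / n * ∑ j, ((τ j : ℤ) : ℝ)) := by
  unfold overlap
  simp_rw [mul_sub, Finset.sum_sub_distrib, ← Finset.sum_mul]
  ring

theorem sum_centered_sq_le {n : ℕ} (hn : 0 < n) (τ : Labeling n) :
    ∑ i, (((τ i : ℤ) : ℝ) - 1 / n * ∑ j, ((τ j : ℤ) : ℝ)) ^ 2 ≤ (n : ℝ) := by
  have hn' : (0 : ℝ) < n := by exact_mod_cast hn
  set s : ℝ := ∑ j, ((τ j : ℤ) : ℝ) with hs
  have : ∑ i, (((τ i : ℤ) : ℝ) - 1 / n * s) ^ 2 = n - s ^ 2 / n := by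
    simp_rw [sub_sq, Finset.sum_add_distrib, Finset.sum_sub_distrib, sq_intUnits_cast,
      ← Finset.sum_mul, ← Finset.mul_sum, ← hs]
    simp
    field_simp
    ring
  rw [this]
  have : 0 ≤ s ^ 2 / n := by positivity
  linarith

/-- The mean square of the linear functional `v` under a weight `μ`, bounded by the mean square
of the inner product of two samples. -/
theorem sq_sum_mul_sq_le {n : ℕ} (μ : Labeling n → ℝ) (v : Fin n → ℝ) :
    (∑ σ, μ σ * (∑ i, ((σ i : ℤ) : ℝ) * v i) ^ 2) ^ 2
      ≤ (∑ σ, ∑ τ, μ σ * μ τ * agreement σ τ ^ 2) * (∑ i, v i ^ 2) ^ 2 := by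
  -- The second moment matrix of `μ`: its squared Frobenius norm is the replica sum, and the left
  -- side pairs it with `v vᵀ`.
  let c : Fin n × Fin n → ℝ := fun e => ∑ σ, μ σ * (((σ e.1 : ℤ) : ℝ) * ((σ e.2 : ℤ) : ℝ))
  have e1 : ∑ σ, μ σ * (∑ i, ((σ i : ℤ) : ℝ) * v i) ^ 2
      = ∑ e : Fin n × Fin n, c e * (v e.1 * v e.2) := by
    simp_rw [c, Finset.sum_mul]
    rw [Finset.sum_comm]
    refine Finset.sum_congr rfl fun σ _ => ?_
    rw [sq, Finset.sum_mul_sum, Fintype.sum_prod_type, Finset.mul_sum]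
    refine Finset.sum_congr rfl fun i _ => ?_
    rw [Finset.mul_sum]
    exact Finset.sum_congr rfl fun j _ => by ring
  have e2 : ∑ σ, ∑ τ, μ σ * μ τ * agreement σ τ ^ 2 = ∑ e, c e ^ 2 := by
    have hc : ∀ e, c e ^ 2 = ∑ σ, ∑ τ, μ σ * (((σ e.1 : ℤ) : ℝ) * ((σ e.2 : ℤ) : ℝ))
        * (μ τ * (((τ e.1 : ℤ) : ℝ) * ((τ e.2 : ℤ) : ℝ))) := fun e => by
      rw [sq, Finset.sum_mul_sum]
    symm
    simp_rw [hc]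
    rw [Finset.sum_comm]
    refine Finset.sum_congr rfl fun σ _ => ?_
    rw [Finset.sum_comm]
    refine Finset.sum_congr rfl fun τ _ => ?_
    rw [agreement, sq, Finset.sum_mul_sum, Fintype.sum_prod_type, Finset.mul_sum]
    refine Finset.sum_congr rfl fun i _ => ?_
    rw [Finset.mul_sum]
    exact Finset.sum_congr rfl fun j _ => by ring
  have e3 : (∑ i, v i ^ 2) ^ 2 = ∑ e : Fin n × Fin n, (v e.1 * v e.2) ^ 2 := by
    simp_rw [mul_pow]
    rw [sq, Finset.sum_mul_sum, Fintype.sum_prod_type]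
  rw [e1, e2, e3]
  exact Finset.sum_mul_sq_le_sq_mul_sq _ _ _

/-- The bound is uniform in the labeling `τ`, so it survives averaging over any randomized estimate.
The parameter `s` linearizes a square root, which makes the bound summable over graphs. -/
theorem sum_mass_mul_overlap_sq_le {n : ℕ} (hn : 0 < n) (p q : unitInterval) {s : ℝ} (hs : 0 < s)
    (G : SimpleGraph (Fin n)) (τ : Labeling n) :
    ∑ σ, mass p q (σ, G) * overlap σ τ ^ 2
      ≤ s / 2 * marginal p q G
        + replicaSum p q (fun σ τ => agreement σ τ ^ 2) G / n ^ 2 / (2 * s) := by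
  have hn' : (0 : ℝ) < n := by exact_mod_cast hn
  let v : Fin n → ℝ := fun i => ((τ i : ℤ) : ℝ) - 1 / n * ∑ j, ((τ j : ℤ) : ℝ)
  set X := ∑ σ, mass p q (σ, G) * overlap σ τ ^ 2 with hX
  set M := marginal p q G with hMdef
  set S := ∑ σ : Labeling n, ∑ τ : Labeling n,
    mass p q (σ, G) * mass p q (τ, G) * agreement σ τ ^ 2 with hSdef
  have hS : 0 ≤ S := by
    refine Finset.sum_nonneg fun σ _ => Finset.sum_nonneg fun τ _ => ?_
    have := mass_nonneg p q (σ, G)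
    have := mass_nonneg p q (τ, G)
    positivity
  have hXe : X * n ^ 2 = ∑ σ, mass p q (σ, G) * (∑ i, ((σ i : ℤ) : ℝ) * v i) ^ 2 := by
    rw [hX, Finset.sum_mul]
    refine Finset.sum_congr rfl fun σ _ => ?_
    have h1 : overlap σ τ * n = ∑ i, ((σ i : ℤ) : ℝ) * v i := by
      rw [overlap_eq, mul_comm, ← mul_assoc, mul_one_div_cancel hn'.ne', one_mul]
    rw [← h1]
    ring
  have hXS : X ^ 2 * n ^ 2 ≤ S := by
    have h1 := sq_sum_mul_sq_le (fun σ => mass p q (σ, G)) v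
    rw [← hXe] at h1
    have h2 : (∑ i, v i ^ 2) ^ 2 ≤ (n : ℝ) ^ 2 :=
      pow_le_pow_left₀ (Finset.sum_nonneg fun i _ => sq_nonneg _) (sum_centered_sq_le hn τ) 2
    have h3 := h1.trans (mul_le_mul_of_nonneg_left h2 hS)
    have : X ^ 2 * (n : ℝ) ^ 2 * n ^ 2 ≤ S * n ^ 2 := by
      calc _ = (X * n ^ 2) ^ 2 := by ring
        _ ≤ _ := h3
    exact le_of_mul_le_mul_right this (by positivity)
  have hR : replicaSum p q (fun σ τ => agreement σ τ ^ 2) G = S / M := rfl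
  rw [hR]
  rcases (marginal_nonneg p q G).eq_or_lt with hM | hM
  · have hz : ∀ σ, mass p q (σ, G) = 0 := fun σ =>
      (Finset.sum_eq_zero_iff_of_nonneg fun σ _ => mass_nonneg p q (σ, G)).1 hM.symm σ
        (Finset.mem_univ _)
    rw [hMdef, ← hM, hX]
    simp [hz]
  · rw [← hMdef] at hM
    have h4 : X ^ 2 / M ≤ S / M / n ^ 2 := by
      rw [div_div, div_le_div_iff₀ hM (by positivity)]
      nlinarith
    -- The arithmetic–geometric mean inequality, as a square completed in `s * M - X`.
    have h5 : X ≤ s / 2 * M + X ^ 2 / M / (2 * s) := by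
      have : s / 2 * M + X ^ 2 / M / (2 * s) - X = (s * M - X) ^ 2 / (2 * s * M) := by
        field_simp
        ring
      have h6 : 0 ≤ (s * M - X) ^ 2 / (2 * s * M) := by positivity
      linarith
    have h7 := div_le_div_of_nonneg_right h4 (by positivity : 0 ≤ 2 * s)
    linarith

/-- Chebyshev's inequality for the law of the overlap. -/
theorem overlapLaw_toMeasure_le {n : ℕ} (p q : unitInterval) (est : Estimate n) {ε C : ℝ}
    (hε : 0 < ε)
    (h : ∑ G, ∑ τ, (est G τ).toReal * ∑ σ, mass p q (σ, G) * overlap σ τ ^ 2 ≤ C) :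
    (overlapLaw p q est).toMeasure {x : ℝ | ε ≤ |x|} ≤ ENNReal.ofReal (C / ε ^ 2) := by
  classical
  have hmeas : MeasurableSet {x : ℝ | ε ≤ |x|} :=
    measurableSet_le measurable_const continuous_abs.measurable
  rw [PMF.toMeasure_apply_eq_toOuterMeasure_apply _ hmeas, overlapLaw,
    PMF.toOuterMeasure_bind_apply, tsum_fintype]
  simp_rw [PMF.toOuterMeasure_map_apply, PMF.toOuterMeasure_apply_fintype]
  have hmodel : ∀ x, model n p q x = ENNReal.ofReal (mass p q x) := fun x => rfl
  have hpt : ∀ x : Labeling n × SimpleGraph (Fin n), model n p q x * ∑ τ,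
      ((fun τ => overlap x.1 τ) ⁻¹' {x : ℝ | ε ≤ |x|}).indicator (est x.2) τ
      ≤ ENNReal.ofReal
        (∑ τ, mass p q x * ((est x.2 τ).toReal * (overlap x.1 τ ^ 2 / ε ^ 2))) := by
    intro x
    have hm := mass_nonneg p q x
    rw [hmodel, ← Finset.mul_sum, ENNReal.ofReal_mul hm,
      ENNReal.ofReal_sum_of_nonneg fun τ _ => by positivity]
    refine mul_le_mul_right (Finset.sum_le_sum fun τ _ => ?_) _
    by_cases hτ : ε ≤ |overlap x.1 τ|
    · rw [Set.indicator_of_mem (by exact hτ), ENNReal.ofReal_mul ENNReal.toReal_nonneg,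
        ENNReal.ofReal_toReal (PMF.apply_ne_top _ _)]
      refine le_mul_of_one_le_right (zero_le) ?_
      rw [ENNReal.one_le_ofReal, one_le_div (by positivity), ← sq_abs (overlap x.1 τ)]
      exact pow_le_pow_left₀ hε.le hτ 2
    · rw [Set.indicator_of_notMem (by exact hτ)]
      exact zero_le
  refine (Finset.sum_le_sum fun x _ => hpt x).trans ?_
  rw [← ENNReal.ofReal_sum_of_nonneg]
  · refine ENNReal.ofReal_le_ofReal (le_trans (le_of_eq ?_)
      (div_le_div_of_nonneg_right h (by positivity)))
    rw [Fintype.sum_prod_type, Finset.sum_comm, Finset.sum_div]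
    refine Finset.sum_congr rfl fun G _ => ?_
    rw [Finset.sum_comm, Finset.sum_div]
    refine Finset.sum_congr rfl fun τ _ => ?_
    rw [Finset.mul_sum, Finset.sum_div]
    exact Finset.sum_congr rfl fun σ _ => by ring
  · intro x _
    have hm := mass_nonneg p q x
    exact Finset.sum_nonneg fun τ _ => by positivity

theorem sum_toReal_apply {α : Type*} [Fintype α] (μ : PMF α) : ∑ x, (μ x).toReal = 1 := by
  have h := μ.tsum_coe
  rw [tsum_fintype] at h
  rw [← ENNReal.toReal_sum fun x _ => PMF.apply_ne_top _ _, h, ENNReal.toReal_one]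

/-- Taking `κ = s ^ 2` makes both error terms without the logarithm linear in `s`: `1 / 2 + 27 / 4 =
29 / 4`. -/
theorem overlapLaw_toMeasure_le_of_near_threshold {n : ℕ} (hn : 0 < n) {p q : unitInterval}
    {m s ε : ℝ} (hm : m = ((p : ℝ) + q) / 2) (h0 : 0 < m) (h1 : m < 1) (hs : 0 < s) (hε : 0 < ε)
    (ht : n * (((p : ℝ) - q) / 2) ^ 2 ≤ (1 + s ^ 2) * (m * (1 - m))) (est : Estimate n) :
    (overlapLaw p q est).toMeasure {x : ℝ | ε ≤ |x|}
      ≤ ENNReal.ofReal ((29 / 4 * s + Real.log (2 * n + 1) / n / (2 * s ^ 3)) / ε ^ 2) := by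
  refine overlapLaw_toMeasure_le p q est hε ?_
  calc _ ≤ ∑ G, ∑ τ, (est G τ).toReal * (s / 2 * marginal p q G
        + replicaSum p q (fun σ τ => agreement σ τ ^ 2) G / n ^ 2 / (2 * s)) :=
        Finset.sum_le_sum fun G _ => Finset.sum_le_sum fun τ _ =>
          mul_le_mul_of_nonneg_left (sum_mass_mul_overlap_sq_le hn p q hs G τ)
            ENNReal.toReal_nonneg
    _ = s / 2 + (∑ G : SimpleGraph (Fin n),
        replicaSum p q (fun σ τ => agreement σ τ ^ 2) G / n ^ 2) / (2 * s) := by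
        simp_rw [← Finset.sum_mul, sum_toReal_apply, one_mul, Finset.sum_add_distrib,
          ← Finset.mul_sum, sum_marginal, mul_one, Finset.sum_div]
    _ ≤ s / 2 + (Real.log (2 * n + 1) / n / s ^ 2 + 27 / 2 * s ^ 2) / (2 * s) := by
        have := sum_replicaSum_agreement_le hn hm h0 h1 (by positivity) ht
        gcongr
    _ = _ := by
        field_simp
        ring

/-! ### Limits and the two regimes -/

theorem tendsto_log_two_mul_add_one_div :
    Tendsto (fun n : ℕ => Real.log (2 * n + 1) / n) atTop (𝓝 0) := by
  have h1 : Tendsto (fun n : ℕ => (2 * n + 1 : ℝ)) atTop atTop :=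
    tendsto_atTop_add_const_right _ _
      (tendsto_natCast_atTop_atTop.const_mul_atTop (by norm_num))
  have h2 := (Real.isLittleO_log_id_atTop.comp_tendsto h1)
  have h3 : (fun n : ℕ => (2 * n + 1 : ℝ)) =O[atTop] fun n : ℕ => (n : ℝ) := by
    refine IsBigO.of_bound 3 ?_
    filter_upwards [eventually_ge_atTop 1] with n hn
    have : (1 : ℝ) ≤ n := by exact_mod_cast hn
    rw [Real.norm_of_nonneg (by positivity), Real.norm_of_nonneg (by positivity)]
    linarith
  exact (h2.trans_isBigO h3).tendsto_div_nhds_zero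

/-- No estimate has asymptotically positive overlap at or below the threshold. -/
theorem tendstoZeroInProbability_overlapLaw (p q : ℕ → unitInterval) {p₀ : ℝ} (hp₀ : p₀ < 1)
    (hp : Tendsto (fun n => (p n : ℝ)) atTop (𝓝 p₀)) (hpos : ∀ᶠ n in atTop, 0 < (p n : ℝ))
    (h : ∀ᶠ n : ℕ in atTop,
      n * ((p n : ℝ) - q n) ^ 2 ≤ 2 * (1 - p₀) * ((p n : ℝ) + q n))
    (est : ∀ n, Estimate n) :
    TendstoZeroInProbability fun n => overlapLaw (p n) (q n) (est n) := by
  have hp₀' : 0 ≤ p₀ := ge_of_tendsto' hp fun n => (p n).2.1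
  have hsq : Tendsto (fun n => ((p n : ℝ) - q n) ^ 2) atTop (𝓝 0) := by
    have h4 : Tendsto (fun n : ℕ => 4 / (n : ℝ)) atTop (𝓝 0) :=
      tendsto_const_nhds.div_atTop tendsto_natCast_atTop_atTop
    refine tendsto_of_tendsto_of_tendsto_of_le_of_le' tendsto_const_nhds h4
      (Eventually.of_forall fun n => sq_nonneg _) ?_
    filter_upwards [h, eventually_ge_atTop 1] with n h1 hn
    have hn' : (0 : ℝ) < n := by exact_mod_cast hn
    rw [le_div_iff₀ hn']
    nlinarith [(p n).2.1, (p n).2.2, (q n).2.1, (q n).2.2]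
  have hd : Tendsto (fun n => (p n : ℝ) - q n) atTop (𝓝 0) := by
    have h5 := (Real.continuous_sqrt.tendsto 0).comp hsq
    rw [Real.sqrt_zero] at h5
    rw [tendsto_zero_iff_abs_tendsto_zero]
    refine h5.congr fun n => ?_
    simp [Real.sqrt_sq_eq_abs]
  have hm : Tendsto (fun n => ((p n : ℝ) + q n) / 2) atTop (𝓝 p₀) := by
    have := hp.sub (hd.div_const 2)
    simp only [zero_div, sub_zero] at this
    exact this.congr fun n => by ring
  intro ε hε
  have hbound : ∀ s : ℝ, 0 < s → ∀ᶠ n : ℕ in atTop,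
      (overlapLaw (p n) (q n) (est n)).toMeasure {x : ℝ | ε ≤ |x|}
        ≤ ENNReal.ofReal ((29 / 4 * s + Real.log (2 * n + 1) / n / (2 * s ^ 3)) / ε ^ 2) := by
    intro s hs
    -- The mean edge probability tends to `p₀`, so the slack `s ^ 2` absorbs the replacement of `1 -
    -- p₀` by one minus that mean.
    have hκ : ∀ᶠ n in atTop, 1 - p₀ < (1 + s ^ 2) * (1 - ((p n : ℝ) + q n) / 2) := by
      refine ((hm.const_sub 1).const_mul (1 + s ^ 2)).eventually (lt_mem_nhds ?_)
      nlinarith [sq_pos_of_pos hs]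
    filter_upwards [h, hpos, hκ, hm.eventually (gt_mem_nhds hp₀), eventually_gt_atTop 0]
      with n h1 h2 h3 h4 h5
    have hq := (q n).2.1
    refine overlapLaw_toMeasure_le_of_near_threshold h5 rfl (by linarith) h4 hs hε ?_ (est n)
    have h6 : 0 ≤ ((p n : ℝ) + q n) / 2 := by linarith
    have h7 := mul_le_mul_of_nonneg_right h3.le h6
    linarith
  rw [ENNReal.tendsto_nhds_zero]
  intro δ hδ
  rcases eq_or_ne δ ⊤ with rfl | hδ'
  · exact Eventually.of_forall fun _ => le_top
  have hδr : 0 < δ.toReal := ENNReal.toReal_pos hδ.ne' hδ'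
  -- The limiting bound is then `29 / 32` of `δ`.
  let s : ℝ := δ.toReal * ε ^ 2 / 8
  have hs : 0 < s := by positivity
  have hlim : Tendsto (fun n : ℕ =>
      (29 / 4 * s + Real.log (2 * n + 1) / n / (2 * s ^ 3)) / ε ^ 2) atTop
      (𝓝 ((29 / 4 * s + 0 / (2 * s ^ 3)) / ε ^ 2)) :=
    ((tendsto_log_two_mul_add_one_div.div_const _).const_add _).div_const _
  have hlt : (29 / 4 * s + 0 / (2 * s ^ 3)) / ε ^ 2 < δ.toReal := by
    rw [div_lt_iff₀ (by positivity), zero_div, add_zero]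
    have : 0 < δ.toReal * ε ^ 2 := by positivity
    simp only [s]
    linarith
  filter_upwards [hbound s hs, hlim.eventually (gt_mem_nhds hlt)] with n h1 h2
  exact h1.trans (ENNReal.ofReal_le_of_le_toReal h2.le)

end

end SBM

theorem theorem3 (p q : ℕ → unitInterval) (a b : ℕ → ℝ)
    (ha : ∀ n, a n = n * (p n : ℝ)) (hb : ∀ n, b n = n * (q n : ℝ)) :
    (Tendsto a atTop atTop → Tendsto b atTop atTop →
      a =o[atTop] (fun n => (n : ℝ)) →
      (∀ᶠ n in atTop, (a n - b n) ^ 2 < 2 * (a n + b n)) →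
      ∀ est : ∀ n, SBM.Estimate n,
        SBM.TendstoZeroInProbability fun n => SBM.overlapLaw (p n) (q n) (est n)) ∧
    (∀ p₀ : ℝ, 0 < p₀ → p₀ < 1 →
      Tendsto (fun n => a n / n) atTop (𝓝 p₀) →
      (∀ᶠ n in atTop, (a n - b n) ^ 2 / (a n + b n) / (2 * (1 - p₀)) < 1) →
      ∀ est : ∀ n, SBM.Estimate n,
        SBM.TendstoZeroInProbability fun n => SBM.overlapLaw (p n) (q n) (est n)) := by
  have hdiv : (fun n => a n / n) =ᶠ[atTop] fun n => (p n : ℝ) := by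
    filter_upwards [eventually_gt_atTop 0] with n hn
    have hn' : (n : ℝ) ≠ 0 := by exact_mod_cast hn.ne'
    rw [ha]
    field_simp
  have hcancel : ∀ {t : ℝ} {n : ℕ}, 0 < n → (a n - b n) ^ 2 ≤ 2 * t * (a n + b n) →
      n * ((p n : ℝ) - q n) ^ 2 ≤ 2 * t * ((p n : ℝ) + q n) := by
    intro t n hn h
    have hn' : (0 : ℝ) < n := by exact_mod_cast hn
    rw [ha, hb] at h
    refine le_of_mul_le_mul_left ?_ hn'
    linarith
  constructor
  · intro hA _ ho hlt est
    have hp : Tendsto (fun n => (p n : ℝ)) atTop (𝓝 0) := ho.tendsto_div_nhds_zero.congr' hdiv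
    -- The sparse regime is the case `p₀ = 0` of the same statement.
    refine SBM.tendstoZeroInProbability_overlapLaw p q one_pos hp ?_ ?_ est
    · filter_upwards [hA.eventually_gt_atTop 0] with n hn
      rw [ha] at hn
      exact pos_of_mul_pos_right hn (Nat.cast_nonneg n)
    · filter_upwards [hlt, eventually_gt_atTop 0] with n h1 h2
      refine hcancel h2 ?_
      linarith
  · intro p₀ h0 h1 ht hlt est
    have hp := ht.congr' hdiv
    have hpos := hp.eventually (lt_mem_nhds h0)
    refine SBM.tendstoZeroInProbability_overlapLaw p q h1 hp hpos ?_ est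
    filter_upwards [hlt, hpos, eventually_gt_atTop 0] with n h2 h3 h4
    refine hcancel h4 ?_
    have hn' : (0 : ℝ) < n := by exact_mod_cast h4
    have hab : 0 < a n + b n := by
      rw [ha, hb]
      have := mul_pos hn' h3
      have := mul_nonneg hn'.le (q n).2.1
      linarith
    rw [div_lt_one (by linarith), div_lt_iff₀ hab] at h2
    exact h2.le
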